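/- Consider an optical wireless link with $N$ transmitter and $M\ge 1$ receiver apertures, $\mathbf y=\frac1{P_{op}}\mathbf H\mathbf x+\mathbf n$. The channel entries are independent and log-normal, $h_{ij}=e^{z_{ij}}$ with $z_{ij}\sim\mathcal N(\mu_{ij},\sigma_{ij}^2)$, $\sigma_{ij}>0$. The noise $\mathbf n$ is independent of $\mathbf H$ and white Gaussian with variance $\sigma_{\mathbf n}^2$ per dimension. The codeword of a symbol vector $\mathbf s=(s_1,\dots,s_L)$, whose entries are drawn independently and uniformly from a finite constellation, is $\mathbf x=\sum_{\ell=1}^L\mathbf F_\ell(s_\ell)\in\mathbb R^N$, and $P_{op}=E[\sum_n x_n]>0$ is the average optical power. Let $\mathcal E$ be the set of all differences of two distinct codewords, and assume that the entries of each $\mathbf e\in\mathcal E$ are all nonzero and of the same sign. Let $\mathbf s,\hat{\mathbf s}$ have distinct codewords, let $\mathbf e=(e_1,\dots,e_N)^T$ be the difference of the two codewords, and let $Q$ be the tail function of the standard normal law. For $\rho>0$ let $$P(\mathbf s\to\hat{\mathbf s})=E_{\mathbf H}\Big[Q\big(\tfrac{d(\mathbf e)}2\big)\Big],\qquad d^2(\mathbf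 e)=\frac{\rho}{NP_{op}^2}\sum_{i=1}^M\Big(\sum_{j=1}^N h_{ij}e_j\Big)^2 .$$ Put $\Omega=\sum_{i=1}^M\sum_{j=1}^N\sigma_{ij}^{-2}$, $$C_L=\frac{\prod_{i,j}\sigma_{ij}}{(4\pi)^{MN}\exp(-\frac{MN}2)}\,Q\Big(\tfrac12\big(\textstyle\sum_{k}e_k^2\big)^{-1/2}\Big),\qquad C_U=\frac{(NP_{op}^2)^{MN}}{2\prod_{i,j}\sqrt{\sigma_{ij}^2}}\exp\Big(-\frac\Omega8\ln^2\frac{NP_{op}^2\Omega}{M}\Big).$$ Then, for all sufficiently large $\rho$, $$C_L(\ln\rho)^{-MN}\exp\Big(-\sum_{i,j}\frac{\big(\ln\rho+\ln(P_{op}^2\Omega)-\ln(M\sum_k e_k^2)\big)^2}{8\sigma_{ij}^2}\Big)\le P(\mathbf s\to\hat{\mathbf s})$$ and $$P(\mathbf s\to\hat{\mathbf s})\le C_U(\ln\rho)^{-MN}\exp\Big(-\sum_{i,j}\frac{\big(\ln\frac{\rho}{\ln^2\rho}+\ln(P_{op}^2\Omega)-\ln e_j^2\big)^2}{8\sigma_{ij}^2}\Big)+\mathcal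 O\Big(\exp\Big(-\sum_{i,j}\frac{\ln^2\rho}{8\sigma_{ij}^2}\Big)\Big)\quad(\rho\to\infty).$$ Both bounds also hold, with the same constants, when $P(\mathbf s\to\hat{\mathbf s})$ is instead the probability, over $\mathbf H$ and $\mathbf n$ with $\rho=\frac1{N\sigma_{\mathbf n}^2}$, that a maximum-likelihood receiver which knows $\mathbf H$ finds $\hat{\mathbf s}$ at least as likely as the transmitted $\mathbf s$. -/

import Mathlib

open MeasureTheory ProbabilityTheory Filter Asymptotics
open scoped NNReal

namespace MimoOwc

/-- The Gaussian tail function `Q(x)`: the probability that a standard normal exceeds `x`. -/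
noncomputable def gaussianQ (x : ℝ) : ℝ := (gaussianReal 0 1).real (Set.Ioi x)

/-- The log-normal law of `h = exp z`, where `z` is normal with mean `m` and variance `s ^ 2`. -/
noncomputable def logNormal (m s : ℝ) : Measure ℝ :=
  (gaussianReal m (s ^ 2).toNNReal).map Real.exp

/-- The law of the `M × N` channel matrix `H` with independent log-normal entries `h i j`. -/
noncomputable def channelLaw {M N : ℕ} (μ σ : Fin M → Fin N → ℝ) :
    Measure (Fin M → Fin N → ℝ) :=
  Measure.pi fun i => Measure.pi fun j => logNormal (μ i j) (σ i j)

/-- The symbol vectors `s = (s_1, …, s_L)` with all entries in the constellation `B`. -/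
def symbolVectors (L : ℕ) (B : Finset ℝ) : Finset (Fin L → ℝ) :=
  Fintype.piFinset fun _ => B

/-- The space codeword `x = ∑ ℓ, F_ℓ (s_ℓ)`. -/
def codeword {L N : ℕ} (F : Fin L → ℝ → Fin N → ℝ) (s : Fin L → ℝ) : Fin N → ℝ :=
  fun n => ∑ ℓ, F ℓ (s ℓ) n

/-- The average optical power `E[∑ n, x_n]`; all symbol vectors are equally likely. -/
noncomputable def averagePower {L N : ℕ} (B : Finset ℝ) (F : Fin L → ℝ → Fin N → ℝ) : ℝ :=
  (∑ s ∈ symbolVectors L B, ∑ n, codeword F s n) / ((symbolVectors L B).card : ℝ)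

/-- The set of error vectors: differences of distinct codewords. -/
def errorSet {L N : ℕ} (B : Finset ℝ) (F : Fin L → ℝ → Fin N → ℝ) : Set (Fin N → ℝ) :=
  {e | ∃ s ∈ symbolVectors L B, ∃ s' ∈ symbolVectors L B,
    codeword F s ≠ codeword F s' ∧ e = codeword F s - codeword F s'}

/-- A real vector is unipolar if it does not have entries of opposite signs. -/
def IsUnipolar {N : ℕ} (e : Fin N → ℝ) : Prop := (∀ j, 0 ≤ e j) ∨ (∀ j, e j ≤ 0)

/-- The distance `d(e)` seen through the channel realization `H`, i.e. the nonnegative root of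
`d(e)² = ρ / (N Pop²) * ∑ i, (h_iᵀ e)²`. -/
noncomputable def distance {M N : ℕ} (Pop ρ : ℝ) (e : Fin N → ℝ) (H : Fin M → Fin N → ℝ) : ℝ :=
  √(ρ / (N * Pop ^ 2) * ∑ i, (∑ j, H i j * e j) ^ 2)

/-- The pairwise error probability `Q(d(e)/2)`, averaged over the channel. -/
noncomputable def pep {M N : ℕ} (μ σ : Fin M → Fin N → ℝ) (Pop : ℝ) (e : Fin N → ℝ) (ρ : ℝ) :
    ℝ :=
  ∫ H, gaussianQ (distance Pop ρ e H / 2) ∂(channelLaw μ σ)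

/-- The received vector `y = (1 / Pop) H x + n`. -/
noncomputable def received {M N : ℕ} (Pop : ℝ) (H : Fin M → Fin N → ℝ) (x : Fin N → ℝ)
    (n : Fin M → ℝ) : Fin M → ℝ :=
  fun i => 1 / Pop * (∑ j, H i j * x j) + n i

/-- The likelihood of the codeword `x` given the received vector `y` and the channel `H`, for white
Gaussian noise of variance `v` per dimension. -/
noncomputable def likelihood {M N : ℕ} (Pop : ℝ) (v : ℝ≥0) (H : Fin M → Fin N → ℝ)
    (y : Fin M → ℝ) (x : Fin N → ℝ) : ℝ :=
  ∏ i, gaussianPDFReal (1 / Pop * ∑ j, H i j * x j) v (y i)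

/-- The probability, over the channel and independent white Gaussian noise of variance `v` per
dimension, that `x` is sent and `x'` is at least as likely as `x` at the receiver, which knows the
channel. -/
noncomputable def mlPairwiseError {M N : ℕ} (μ σ : Fin M → Fin N → ℝ) (Pop : ℝ)
    (x x' : Fin N → ℝ) (v : ℝ≥0) : ℝ :=
  ((channelLaw μ σ).prod (Measure.pi fun _ : Fin M => gaussianReal 0 v)).real
    {w | likelihood Pop v w.1 (received Pop w.1 x w.2) x ≤
         likelihood Pop v w.1 (received Pop w.1 x w.2) x'}

/-- `Ω = ∑ i, ∑ j, σ i j ^ (-2)`. -/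
noncomputable def bigOmega {M N : ℕ} (σ : Fin M → Fin N → ℝ) : ℝ :=
  ∑ i, ∑ j, (σ i j ^ 2)⁻¹

/-- The constant `C_L`. -/
noncomputable def constL {M N : ℕ} (σ : Fin M → Fin N → ℝ) (e : Fin N → ℝ) : ℝ :=
  (∏ i, ∏ j, σ i j) / ((4 * Real.pi) ^ (M * N) * Real.exp (-((M : ℝ) * N / 2))) *
    gaussianQ (1 / 2 * (√(∑ k, e k ^ 2))⁻¹)

/-- The constant `C_U`. -/
noncomputable def constU {M N : ℕ} (σ : Fin M → Fin N → ℝ) (Pop : ℝ) : ℝ :=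
  (N * Pop ^ 2) ^ (M * N) / (2 * ∏ i, ∏ j, √(σ i j ^ 2)) *
    Real.exp (-(bigOmega σ / 8 * Real.log (N * Pop ^ 2 * bigOmega σ / M) ^ 2))

/-- The lower bound `P_L`. -/
noncomputable def lowerBound {M N : ℕ} (σ : Fin M → Fin N → ℝ) (Pop : ℝ) (e : Fin N → ℝ)
    (ρ : ℝ) : ℝ :=
  constL σ e * (Real.log ρ ^ (M * N))⁻¹ *
    Real.exp (-∑ i, ∑ j,
      (Real.log ρ + Real.log (Pop ^ 2 * bigOmega σ) - Real.log (M * ∑ k, e k ^ 2)) ^ 2 /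
        (8 * σ i j ^ 2))

/-- The main term `P_U` of the upper bound. -/
noncomputable def upperBound {M N : ℕ} (σ : Fin M → Fin N → ℝ) (Pop : ℝ) (e : Fin N → ℝ)
    (ρ : ℝ) : ℝ :=
  constU σ Pop * (Real.log ρ ^ (M * N))⁻¹ *
    Real.exp (-∑ i, ∑ j,
      (Real.log (ρ / Real.log ρ ^ 2) + Real.log (Pop ^ 2 * bigOmega σ) - Real.log (e j ^ 2)) ^ 2 /
        (8 * σ i j ^ 2))

/-- The size of the remainder of the upper bound. -/
noncomputable def remainder {M N : ℕ} (σ : Fin M → Fin N → ℝ) (ρ : ℝ) : ℝ :=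
  Real.exp (-∑ i, ∑ j, Real.log ρ ^ 2 / (8 * σ i j ^ 2))

/-- `A ρ ≤ P ρ ≤ B ρ + O(R ρ)` for all sufficiently large `ρ`. -/
def AsymptoticallyBounded (A P B R : ℝ → ℝ) : Prop :=
  (∀ᶠ ρ in atTop, A ρ ≤ P ρ) ∧
    ∃ r : ℝ → ℝ, r =O[atTop] R ∧ ∀ᶠ ρ in atTop, P ρ ≤ B ρ + r ρ

end MimoOwc

/-! Conditionally on the channel, the noise enters the likelihood comparison only through one
Gaussian linear functional, so for noise variance `v` the maximum-likelihood error probability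
*equals* the averaged `Q`-function at signal-to-noise ratio `N / v`; it suffices to bound the
latter.

From above, `Q x ≤ exp (-x² / 2)`, and for unipolar `e` the square `(∑ j, h j * e j)²` dominates
`∑ j, (h j * e j)²`, so the bound factorises over the independent gains into Laplace transforms of
squared log-normals. These are estimated by the moments of order `-2 * a` through
`exp (-y) ≤ (a / (exp 1 * y)) ^ a`.

From below, only the deep fades in which all gains are at most `√(log ρ / ρ)` are kept. There the
distance is `O(√(log ρ))`, so `Q` costs no more than a power of `ρ`.

With `x = log ρ`, the exponents so obtained differ from those of the theorem by terms of order
`x * log x`, in the favourable direction. This gain beats every power of `ρ`, hence also the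
constants `C_L` and `C_U` and the factor `(log ρ) ^ (-M * N)`. -/

namespace MimoOwc

open Real Set

section GaussianTail

lemma gaussianQ_antitone : Antitone gaussianQ := fun _ _ h =>
  measureReal_mono (Ioi_subset_Ioi h)

lemma gaussianQ_nonneg (x : ℝ) : 0 ≤ gaussianQ x := measureReal_nonneg

lemma gaussianQ_le_one (x : ℝ) : gaussianQ x ≤ 1 := measureReal_le_one

lemma gaussianQ_le_exp {x : ℝ} (hx : 0 ≤ x) : gaussianQ x ≤ exp (-(x ^ 2 / 2)) :=
  calc gaussianQ x ≤ (gaussianReal 0 1).real {y | x ≤ id y} :=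
        measureReal_mono fun _ (hy : x < _) => hy.le
    _ ≤ exp (-x * x) * mgf id (gaussianReal 0 1) x :=
        measure_ge_le_exp_mul_mgf x hx (by simpa using integrable_exp_mul_gaussianReal x)
    _ = exp (-(x ^ 2 / 2)) := by
        rw [mgf_id_gaussianReal, ← exp_add, NNReal.coe_one]
        ring_nf

lemma sqrt_two_pi_le_exp_one : √(2 * π) ≤ exp 1 := by
  have h : 2.7182818283 < exp 1 := exp_one_gt_d9
  rw [sqrt_le_left (exp_pos 1).le]
  nlinarith [pi_lt_d2]

lemma exp_neg_add_two_sq_le_gaussianQ {x : ℝ} (hx : 0 ≤ x) :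
    exp (-((x + 2) ^ 2 / 2)) ≤ gaussianQ x := by
  have hpdf : ∀ y ∈ Ioc x (x + 1), exp (-((x + 2) ^ 2 / 2)) ≤ gaussianPDFReal 0 1 y := by
    rintro y ⟨hxy, hyx⟩
    calc exp (-((x + 2) ^ 2 / 2)) ≤ exp (-1 + -(y ^ 2 / 2)) := by
          gcongr
          nlinarith
      _ = (exp 1)⁻¹ * exp (-(y ^ 2 / 2)) := by rw [exp_add, exp_neg 1]
      _ ≤ (√(2 * π))⁻¹ * exp (-(y ^ 2 / 2)) := by
          gcongr
          exact sqrt_two_pi_le_exp_one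
      _ = gaussianPDFReal 0 1 y := by simp [gaussianPDFReal, neg_div]
  calc exp (-((x + 2) ^ 2 / 2)) ≤ ∫ y in Ioc x (x + 1), gaussianPDFReal 0 1 y := by
        simpa using setIntegral_ge_of_const_le_real measurableSet_Ioc (by simp) hpdf
          (integrable_gaussianPDFReal 0 1).integrableOn
    _ = (gaussianReal 0 1).real (Ioc x (x + 1)) := by
        rw [measureReal_def, gaussianReal_apply_eq_integral 0 one_ne_zero,
          ENNReal.toReal_ofReal (integral_nonneg fun y => gaussianPDFReal_nonneg _ _ _)]
    _ ≤ gaussianQ x := measureReal_mono Ioc_subset_Ioi_self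

lemma gaussianReal_real_Iic (m : ℝ) {v : ℝ≥0} (hv : v ≠ 0) (x : ℝ) :
    (gaussianReal m v).real (Iic x) = gaussianQ ((m - x) / √v) := by
  have hv' : 0 < √(v : ℝ) := sqrt_pos.2 (by exact_mod_cast pos_iff_ne_zero.2 hv)
  have hmap : (gaussianReal m v).map (fun y => (m - y) / √v) = gaussianReal 0 1 := by
    rw [← Function.comp_def (· / √(v : ℝ)) (m - ·),
      ← Measure.map_map (by fun_prop) (by fun_prop), gaussianReal_map_const_sub,
      gaussianReal_map_div_const, sub_self, zero_div]
    congr 1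
    ext
    simp [hv]
  have : NullSingletonClass (gaussianReal 0 1) := nullSingletonClass_gaussianReal one_ne_zero
  have hpre : (fun y => (m - y) / √v) ⁻¹' Ici ((m - x) / √v) = Iic x := by
    ext y
    simp only [mem_preimage, mem_Ici, mem_Iic, div_le_div_iff_of_pos_right hv', sub_le_sub_iff_left]
  rw [gaussianQ, measureReal_congr Ioi_ae_eq_Ici, ← hmap,
    map_measureReal_apply (by fun_prop) measurableSet_Ici, hpre]

lemma map_sum_mul_pi_gaussianReal {ι : Type*} [Fintype ι] (v : ℝ≥0) (δ : ι → ℝ) :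
    (Measure.pi fun _ : ι => gaussianReal 0 v).map (fun n => ∑ i, n i * δ i) =
      gaussianReal 0 ((∑ i, δ i ^ 2).toNNReal * v) := by
  have hcomp : (fun n : ι → ℝ => ∑ i, n i * δ i) =
      (fun p : ι → ℝ => ∑ i, p i) ∘ fun n i => n i * δ i := rfl
  rw [hcomp, ← Measure.map_map (by fun_prop) (by fun_prop),
    Measure.pi_map_pi (f := fun i x => x * δ i) (fun i => by fun_prop)]
  refine Measure.ext_of_charFun (funext fun t => ?_)
  simp only [gaussianReal_map_mul_const, charFun_map_sum_pi_eq_prod, Finset.prod_apply,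
    charFun_gaussianReal, ← Complex.exp_sum]
  simp [Finset.sum_mul, Finset.sum_div, Finset.sum_neg_distrib, Finset.sum_nonneg, sq_nonneg]

end GaussianTail

section LogNormal

instance (m s : ℝ) : IsProbabilityMeasure (logNormal m s) :=
  Measure.isProbabilityMeasure_map (by fun_prop)

lemma ae_logNormal_pos (m s : ℝ) : ∀ᵐ h ∂logNormal m s, 0 < h := by
  rw [logNormal, ae_map_iff (by fun_prop) measurableSet_Ioi]
  exact Eventually.of_forall exp_pos

lemma logNormal_real_Ioc (m : ℝ) {s t : ℝ} (hs : 0 < s) (ht : 0 < t) :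
    (logNormal m s).real (Ioc 0 t) = gaussianQ ((m - log t) / s) := by
  have hpre : exp ⁻¹' Ioc 0 t = Iic (log t) := by
    ext z
    simp [exp_pos, le_log_iff_exp_le ht]
  have hv : (s ^ 2).toNNReal ≠ 0 := (toNNReal_pos.2 (by positivity)).ne'
  rw [logNormal, map_measureReal_apply (by fun_prop) measurableSet_Ioc, hpre,
    gaussianReal_real_Iic m hv, coe_toNNReal _ (sq_nonneg s), sqrt_sq hs.le]

lemma integrable_rpow_logNormal (m s p : ℝ) : Integrable (fun h => h ^ p) (logNormal m s) := by
  rw [logNormal, integrable_map_measure (by fun_prop) (by fun_prop)]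
  simpa only [Function.comp_def, ← exp_mul, mul_comm] using integrable_exp_mul_gaussianReal p

lemma integral_rpow_logNormal (m s p : ℝ) :
    ∫ h, h ^ p ∂logNormal m s = exp (m * p + s ^ 2 * p ^ 2 / 2) := by
  have h := congrFun (mgf_id_gaussianReal (μ := m) (v := (s ^ 2).toNNReal)) p
  rw [coe_toNNReal _ (sq_nonneg s)] at h
  rw [← h, logNormal, integral_map (by fun_prop) (by fun_prop), mgf]
  simp only [← exp_mul, id_eq, mul_comm]

lemma exp_neg_le_exp_mul_log {a y : ℝ} (ha : 0 < a) (hy : 0 < y) :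
    exp (-y) ≤ exp (a * log (a / y) - a) := by
  have h := mul_le_mul_of_nonneg_left (log_le_sub_one_of_pos (div_pos hy ha)) ha.le
  rw [mul_sub, mul_div_cancel₀ _ ha.ne', ← inv_div a y, log_inv] at h
  gcongr
  linarith

lemma integral_exp_neg_mul_sq_logNormal_le (m s : ℝ) {κ a : ℝ} (hκ : 0 < κ) (ha : 0 < a) :
    ∫ h, exp (-(κ * h ^ 2)) ∂logNormal m s ≤
      exp (a * log (a / κ) - a - 2 * a * m + 2 * a ^ 2 * s ^ 2) := by
  have hpow {h : ℝ} (hh : 0 < h) :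
      exp (-(κ * h ^ 2)) ≤ exp (a * log (a / κ) - a) * h ^ (-2 * a) :=
    calc exp (-(κ * h ^ 2)) ≤ exp (a * log (a / (κ * h ^ 2)) - a) :=
          exp_neg_le_exp_mul_log ha (by positivity)
      _ = exp (a * log (a / κ) - a) * h ^ (-2 * a) := by
          rw [← div_div, log_div (by positivity) (by positivity), log_pow,
            rpow_def_of_pos hh, ← exp_add]
          push_cast
          ring_nf
  calc ∫ h, exp (-(κ * h ^ 2)) ∂logNormal m s
      ≤ ∫ h, exp (a * log (a / κ) - a) * h ^ (-2 * a) ∂logNormal m s :=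
        integral_mono_of_nonneg (Eventually.of_forall fun h => (exp_pos _).le)
          ((integrable_rpow_logNormal m s _).const_mul _) <| by
            filter_upwards [ae_logNormal_pos m s] with h hh using hpow hh
    _ = _ := by
        rw [integral_const_mul, integral_rpow_logNormal, ← exp_add]
        ring_nf

end LogNormal

section Asymptotics

-- Expanding the square yields the cross term `-2 * k * x * log x`: half of it is kept, the other
-- half absorbs everything of order `x`.
lemma eventually_sq_sub_mul_log_add_le {k : ℝ} (hk : 0 < k) (A B : ℝ) :
    ∀ᶠ x in atTop, (x - k * log x + A) ^ 2 ≤ x ^ 2 - k * x * log x + B * x := by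
  filter_upwards [(isLittleO_pow_log_id_atTop (n := 2)).def one_pos, eventually_ge_atTop 1,
    (tendsto_log_atTop.const_mul_atTop hk).eventually_ge_atTop
      (2 * A ^ 2 + 2 * k ^ 2 + 2 * A - B)] with x hlog hx hlarge
  have hlog_sq : log x ^ 2 ≤ x := by simpa [abs_of_nonneg (zero_le_one.trans hx)] using hlog
  have hquad : (A - k * log x) ^ 2 ≤ (2 * A ^ 2 + 2 * k ^ 2) * x :=
    calc (A - k * log x) ^ 2 ≤ 2 * A ^ 2 * 1 + 2 * k ^ 2 * log x ^ 2 := by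
          nlinarith [sq_nonneg (A + k * log x)]
      _ ≤ (2 * A ^ 2 + 2 * k ^ 2) * x := by
          rw [add_mul]
          gcongr
  nlinarith

lemma tendsto_sub_log_atTop : Tendsto (fun x => x - log x) atTop atTop :=
  (IsEquivalent.refl.sub_isLittleO isLittleO_log_id_atTop).symm.tendsto_atTop tendsto_id

lemma eventually_mul_inv_pow_le_exp (c : ℝ) (n : ℕ) :
    ∀ᶠ x in atTop, c * (x ^ n)⁻¹ ≤ exp x := by
  filter_upwards [eventually_ge_atTop 1, tendsto_exp_atTop.eventually_ge_atTop |c|] with x hx hc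
  calc c * (x ^ n)⁻¹ ≤ |c| * (x ^ n)⁻¹ := by
        gcongr
        exact le_abs_self c
    _ ≤ |c| := mul_le_of_le_one_right (abs_nonneg c) (inv_le_one_of_one_le₀ (one_le_pow₀ hx))
    _ ≤ exp x := hc

lemma eventually_exp_neg_le_mul_inv_pow {c : ℝ} (hc : 0 < c) (n : ℕ) :
    ∀ᶠ x in atTop, exp (-x) ≤ c * (x ^ n)⁻¹ := by
  filter_upwards [(isLittleO_pow_exp_pos_mul_atTop n one_pos).def hc, eventually_gt_atTop 0]
    with x h hx
  rw [one_mul, norm_of_nonneg (by positivity), norm_of_nonneg (exp_pos x).le] at h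
  rw [exp_neg, ← div_eq_mul_inv, le_div_iff₀ (by positivity), inv_mul_le_iff₀ (exp_pos x),
    mul_comm]
  exact h

lemma log_div_log_sq {ρ : ℝ} (hρ : 0 < ρ) (hlog : 0 < log ρ) :
    log (ρ / log ρ ^ 2) = log ρ - 2 * log (log ρ) := by
  rw [log_div hρ.ne' (by positivity), log_pow, Nat.cast_ofNat]

lemma eventually_exp_le_gaussianQ_mul_sqrt {K : ℝ} (hK : 0 ≤ K) :
    ∀ᶠ x in atTop, exp (-((K ^ 2 + 1) * x)) ≤ gaussianQ (K * √x) := by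
  filter_upwards [eventually_ge_atTop 4] with x hx
  refine le_trans ?_ (exp_neg_add_two_sq_le_gaussianQ (by positivity))
  have hsq : √x ^ 2 = x := sq_sqrt (by linarith)
  gcongr
  nlinarith [sq_nonneg (K * √x - 2)]

lemma eventually_exp_le_logNormal_real_Ioc (m A C : ℝ) {s : ℝ} (hs : 0 < s) :
    ∀ᶠ ρ in atTop, exp (C * log ρ - (log ρ + A) ^ 2 / (8 * s ^ 2)) ≤
      (logNormal m s).real (Ioc 0 √(log ρ / ρ)) := by
  filter_upwards [eventually_gt_atTop 0, tendsto_log_atTop.eventually_ge_atTop 1,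
    tendsto_log_atTop.eventually (tendsto_sub_log_atTop.eventually_ge_atTop (-(2 * m))),
    tendsto_log_atTop.eventually (eventually_sq_sub_mul_log_add_le one_pos
      (2 * m + 4 * s) (2 * A - 8 * s ^ 2 * C))] with ρ hρ hℓ hlarge hgap
  have hℓ0 : 0 < log ρ := by linarith
  have hlog : log √(log ρ / ρ) = -((log ρ - log (log ρ)) / 2) := by
    rw [log_sqrt (by positivity), log_div hℓ0.ne' hρ.ne']
    ring
  rw [logNormal_real_Ioc m hs (by positivity), hlog]
  refine le_trans ?_ (exp_neg_add_two_sq_le_gaussianQ (div_nonneg (by linarith) hs.le))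
  have hsquare : ((m - -((log ρ - log (log ρ)) / 2)) / s + 2) ^ 2 / 2 =
      (log ρ - 1 * log (log ρ) + (2 * m + 4 * s)) ^ 2 / (8 * s ^ 2) := by
    field_simp
    ring
  have hbound : (log ρ - 1 * log (log ρ) + (2 * m + 4 * s)) ^ 2 ≤
      (log ρ + A) ^ 2 - 8 * s ^ 2 * (C * log ρ) := by
    nlinarith [mul_nonneg hℓ0.le (log_nonneg hℓ), sq_nonneg A]
  rw [hsquare, ← neg_sub, exp_le_exp, neg_le_neg_iff, div_le_iff₀ (by positivity), sub_mul,
    div_mul_cancel₀ _ (by positivity)]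
  linarith

lemma eventually_integral_exp_neg_mul_sq_logNormal_le (m A C : ℝ) {s κ : ℝ} (hs : 0 < s)
    (hκ : 0 < κ) :
    ∀ᶠ ρ in atTop, ∫ h, exp (-(κ * ρ * h ^ 2)) ∂logNormal m s ≤
      exp (-(C * log ρ) - (log (ρ / log ρ ^ 2) + A) ^ 2 / (8 * s ^ 2)) := by
  filter_upwards [eventually_gt_atTop 0, tendsto_log_atTop.eventually_gt_atTop 0,
    tendsto_log_atTop.eventually (eventually_sq_sub_mul_log_add_le two_pos A
      (2 * (log (4 * s ^ 2 * κ) + 1 + 2 * m) - 8 * s ^ 2 * C))] with ρ hρ hℓ hgap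
  -- `2 * a ^ 2 * s ^ 2 - a * log ρ`, the dominant part of the exponent, is minimal at this `a`.
  set a := log ρ / (4 * s ^ 2) with ha
  refine (integral_exp_neg_mul_sq_logNormal_le m s (mul_pos hκ hρ)
    (a := a) (by positivity)).trans (exp_le_exp.2 ?_)
  have hlog : log (a / (κ * ρ)) = log (log ρ) - log (4 * s ^ 2 * κ) - log ρ := by
    rw [ha, div_div, ← mul_assoc, log_div hℓ.ne' (by positivity),
      log_mul (by positivity) hρ.ne', sub_sub]
  have hexponent : a * log (a / (κ * ρ)) - a - 2 * a * m + 2 * a ^ 2 * s ^ 2 =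
      -(log ρ ^ 2 - 2 * log ρ * log (log ρ) + 2 * (log (4 * s ^ 2 * κ) + 1 + 2 * m) * log ρ) /
        (8 * s ^ 2) := by
    rw [hlog, ha]
    field_simp
    ring
  rw [hexponent, log_div_log_sq hρ hℓ, div_le_iff₀ (by positivity), sub_mul,
    div_mul_cancel₀ _ (by positivity)]
  linarith

end Asymptotics

section Channel

variable {M N : ℕ}

instance (μ σ : Fin M → Fin N → ℝ) : IsProbabilityMeasure (channelLaw μ σ) := by
  unfold channelLaw
  infer_instance

lemma ae_channelLaw_pos (μ σ : Fin M → Fin N → ℝ) : ∀ᵐ H ∂channelLaw μ σ, ∀ i j, 0 < H i j :=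
  ae_all_iff.2 fun i =>
    (Measure.tendsto_eval_ae_ae (μ := fun i => Measure.pi fun j =>
      logNormal (μ i j) (σ i j)) (i := i)).eventually <|
    ae_all_iff.2 fun _ => Measure.tendsto_eval_ae_ae.eventually (ae_logNormal_pos _ _)

lemma prod_prod_exp_div_sub (hM : 0 < M) (hN : 0 < N) (c : ℝ) (f : Fin M → Fin N → ℝ) :
    ∏ i, ∏ j, exp (c / (M * N) - f i j) = exp (c - ∑ i, ∑ j, f i j) := by
  simp only [← exp_sum, Finset.sum_sub_distrib, Finset.sum_const, Finset.card_univ,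
    Fintype.card_fin, nsmul_eq_mul, ← mul_assoc]
  rw [mul_div_cancel₀ c (by positivity)]

/-- The deep-fade event that all gains of the channel matrix lie in `(0, t]`; the lower bounds on
the error probability come from this event alone. -/
def channelBox (M N : ℕ) (t : ℝ) : Set (Fin M → Fin N → ℝ) :=
  univ.pi fun _ => univ.pi fun _ => Ioc 0 t

lemma measurableSet_channelBox (M N : ℕ) (t : ℝ) : MeasurableSet (channelBox M N t) :=
  MeasurableSet.univ_pi fun _ => MeasurableSet.univ_pi fun _ => measurableSet_Ioc

lemma channelLaw_real_channelBox (μ σ : Fin M → Fin N → ℝ) (t : ℝ) :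
    (channelLaw μ σ).real (channelBox M N t) =
      ∏ i, ∏ j, (logNormal (μ i j) (σ i j)).real (Ioc 0 t) := by
  simp only [measureReal_def, channelLaw, channelBox, Measure.pi_pi, ENNReal.toReal_prod]

lemma eventually_exp_le_channelLaw_real_channelBox (hM : 0 < M) (hN : 0 < N)
    (μ : Fin M → Fin N → ℝ) {σ : Fin M → Fin N → ℝ} (hσ : ∀ i j, 0 < σ i j) (A C : ℝ) :
    ∀ᶠ ρ in atTop, exp (C * log ρ - ∑ i, ∑ j, (log ρ + A) ^ 2 / (8 * σ i j ^ 2)) ≤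
      (channelLaw μ σ).real (channelBox M N √(log ρ / ρ)) := by
  filter_upwards [eventually_all.2 fun i => eventually_all.2 fun j =>
    eventually_exp_le_logNormal_real_Ioc (μ i j) A (C / (M * N)) (hσ i j)] with ρ hρ
  rw [channelLaw_real_channelBox, ← prod_prod_exp_div_sub hM hN]
  simp only [← div_mul_eq_mul_div] at hρ ⊢
  gcongr with i _ j _
  exact hρ i j

lemma integral_channelLaw_exp (μ σ : Fin M → Fin N → ℝ) (κ : Fin N → ℝ) :
    ∫ H, exp (-∑ i, ∑ j, κ j * H i j ^ 2) ∂channelLaw μ σ =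
      ∏ i, ∏ j, ∫ h, exp (-(κ j * h ^ 2)) ∂logNormal (μ i j) (σ i j) := by
  simp_rw [← Finset.sum_neg_distrib, exp_sum, channelLaw]
  rw [integral_fintype_prod_eq_prod (f := fun i (x : Fin N → ℝ) =>
    ∏ j, exp (-(κ j * x j ^ 2)))]
  refine Finset.prod_congr rfl fun i _ => ?_
  rw [integral_fintype_prod_eq_prod (f := fun j (x : ℝ) => exp (-(κ j * x ^ 2)))]

lemma eventually_integral_channelLaw_exp_le (hM : 0 < M) (hN : 0 < N) (μ : Fin M → Fin N → ℝ)
    {σ : Fin M → Fin N → ℝ} (hσ : ∀ i j, 0 < σ i j) {κ : Fin N → ℝ} (hκ : ∀ j, 0 < κ j)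
    (A : Fin N → ℝ) (C : ℝ) :
    ∀ᶠ ρ in atTop, ∫ H, exp (-∑ i, ∑ j, κ j * ρ * H i j ^ 2) ∂channelLaw μ σ ≤
      exp (-(C * log ρ) -
        ∑ i, ∑ j, (log (ρ / log ρ ^ 2) + A j) ^ 2 / (8 * σ i j ^ 2)) := by
  filter_upwards [eventually_all.2 fun i => eventually_all.2 fun j =>
    eventually_integral_exp_neg_mul_sq_logNormal_le (μ i j) (A j) (C / (M * N)) (hσ i j) (hκ j)]
    with ρ hρ
  rw [integral_channelLaw_exp μ σ fun j => κ j * ρ, ← prod_prod_exp_div_sub hM hN]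
  simp only [neg_div, ← div_mul_eq_mul_div] at hρ ⊢
  gcongr with i _ j _
  exact hρ i j

lemma integrable_exp_neg_sum (μ σ : Fin M → Fin N → ℝ) {κ : Fin N → ℝ} (hκ : ∀ j, 0 ≤ κ j) :
    Integrable (fun H => exp (-∑ i, ∑ j, κ j * H i j ^ 2)) (channelLaw μ σ) := by
  refine Integrable.of_bound (C := 1) (by fun_prop : Measurable _).aestronglyMeasurable
    (Eventually.of_forall fun H => ?_)
  rw [norm_of_nonneg (exp_pos _).le]
  exact exp_le_one_iff.2 (neg_nonpos.2 (Finset.sum_nonneg fun i _ =>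
    Finset.sum_nonneg fun j _ => mul_nonneg (hκ j) (sq_nonneg _)))

end Channel

section PairwiseErrorProbability

variable {M N : ℕ}

lemma IsUnipolar.mul_of_nonneg {e h : Fin N → ℝ} (he : IsUnipolar e) (hh : ∀ j, 0 ≤ h j) :
    IsUnipolar fun j => h j * e j :=
  he.imp (fun he j => mul_nonneg (hh j) (he j))
    fun he j => mul_nonpos_of_nonneg_of_nonpos (hh j) (he j)

lemma IsUnipolar.sum_sq_le_sq_sum {e : Fin N → ℝ} (he : IsUnipolar e) :
    ∑ j, e j ^ 2 ≤ (∑ j, e j) ^ 2 := by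
  rcases he with he | he
  · exact Finset.sum_sq_le_sq_sum_of_nonneg fun j _ => he j
  · simpa only [Finset.sum_neg_distrib, neg_sq] using
      Finset.sum_sq_le_sq_sum_of_nonneg (s := Finset.univ) (f := fun j => -e j)
        fun j _ => neg_nonneg.2 (he j)

lemma distance_nonneg (Pop ρ : ℝ) (e : Fin N → ℝ) (H : Fin M → Fin N → ℝ) :
    0 ≤ distance Pop ρ e H :=
  sqrt_nonneg _

lemma sq_distance (Pop : ℝ) {ρ : ℝ} (hρ : 0 ≤ ρ) (e : Fin N → ℝ) (H : Fin M → Fin N → ℝ) :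
    distance Pop ρ e H ^ 2 = ρ / (N * Pop ^ 2) * ∑ i, (∑ j, H i j * e j) ^ 2 :=
  sq_sqrt (by positivity)

lemma measurable_distance (Pop ρ : ℝ) (e : Fin N → ℝ) :
    Measurable (distance (M := M) Pop ρ e) := by
  unfold distance
  fun_prop

lemma integrable_gaussianQ_distance (μ σ : Fin M → Fin N → ℝ) (Pop ρ : ℝ) (e : Fin N → ℝ) :
    Integrable (fun H => gaussianQ (distance Pop ρ e H / 2)) (channelLaw μ σ) := by
  refine Integrable.of_bound (C := 1) ?_ (Eventually.of_forall fun H => ?_)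
  · exact (gaussianQ_antitone.measurable.comp
      ((measurable_distance Pop ρ e).div_const 2)).aestronglyMeasurable
  · rw [norm_of_nonneg (gaussianQ_nonneg _)]
    exact gaussianQ_le_one _

lemma abs_sum_le_of_mem_channelBox {t : ℝ} {H : Fin M → Fin N → ℝ} (hH : H ∈ channelBox M N t)
    (e : Fin N → ℝ) (i : Fin M) : |∑ j, H i j * e j| ≤ t * ∑ j, |e j| :=
  calc |∑ j, H i j * e j| ≤ ∑ j, |H i j * e j| := Finset.abs_sum_le_sum_abs _ _
    _ ≤ ∑ j, t * |e j| := by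
        gcongr with j
        have h : H i j ∈ Ioc 0 t := hH i trivial j trivial
        rw [abs_mul, abs_of_pos h.1]
        gcongr
        exact h.2
    _ = t * ∑ j, |e j| := (Finset.mul_sum _ _ _).symm

lemma distance_le_of_mem_channelBox (Pop : ℝ) {ρ t : ℝ} (hρ : 0 ≤ ρ) (ht : 0 ≤ t)
    (e : Fin N → ℝ) {H : Fin M → Fin N → ℝ} (hH : H ∈ channelBox M N t) :
    distance Pop ρ e H ≤ √(ρ * M / (N * Pop ^ 2)) * (t * ∑ j, |e j|) := by
  refine sqrt_le_iff.2 ⟨by positivity, ?_⟩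
  calc ρ / (N * Pop ^ 2) * ∑ i, (∑ j, H i j * e j) ^ 2
      ≤ ρ / (N * Pop ^ 2) * ∑ _i : Fin M, (t * ∑ j, |e j|) ^ 2 := by
        gcongr ρ / (N * Pop ^ 2) * ∑ i, ?_ with i
        exact sq_le_sq.2 ((abs_sum_le_of_mem_channelBox hH e i).trans (le_abs_self _))
    _ = (√(ρ * M / (N * Pop ^ 2)) * (t * ∑ j, |e j|)) ^ 2 := by
        rw [mul_pow √_, sq_sqrt (by positivity), Finset.sum_const, Finset.card_univ,
          Fintype.card_fin, nsmul_eq_mul]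
        ring

lemma gaussianQ_mul_channelLaw_real_le_pep (μ σ : Fin M → Fin N → ℝ) (Pop : ℝ) (e : Fin N → ℝ)
    {ρ t : ℝ} (hρ : 0 ≤ ρ) (ht : 0 ≤ t) :
    gaussianQ (√(ρ * M / (N * Pop ^ 2)) * (t * ∑ j, |e j|) / 2) *
      (channelLaw μ σ).real (channelBox M N t) ≤ pep μ σ Pop e ρ := by
  rw [mul_comm, ← smul_eq_mul, ← integral_indicator_const _ (measurableSet_channelBox M N t)]
  refine integral_mono_of_nonneg (Eventually.of_forall fun H =>
    indicator_nonneg (fun _ _ => gaussianQ_nonneg _) _)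
    (integrable_gaussianQ_distance μ σ Pop ρ e) (Eventually.of_forall fun H => ?_)
  refine indicator_apply_le' (fun hH => gaussianQ_antitone ?_) fun _ => gaussianQ_nonneg _
  gcongr
  exact distance_le_of_mem_channelBox Pop hρ ht e hH

lemma pep_le_integral_exp (μ σ : Fin M → Fin N → ℝ) (Pop : ℝ) {e : Fin N → ℝ}
    (he : IsUnipolar e) {ρ : ℝ} (hρ : 0 ≤ ρ) :
    pep μ σ Pop e ρ ≤
      ∫ H, exp (-∑ i, ∑ j, ρ * e j ^ 2 / (8 * (N * Pop ^ 2)) * H i j ^ 2) ∂channelLaw μ σ := by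
  refine integral_mono_of_nonneg (Eventually.of_forall fun H => gaussianQ_nonneg _)
    (integrable_exp_neg_sum μ σ fun j => by positivity) ?_
  filter_upwards [ae_channelLaw_pos μ σ] with H hH
  refine (gaussianQ_le_exp (div_nonneg (distance_nonneg Pop ρ e H) zero_le_two)).trans ?_
  rw [exp_le_exp, neg_le_neg_iff, div_pow, sq_distance Pop hρ]
  calc ∑ i, ∑ j, ρ * e j ^ 2 / (8 * (N * Pop ^ 2)) * H i j ^ 2
      = ρ / (N * Pop ^ 2) * (∑ i, ∑ j, (H i j * e j) ^ 2) / 2 ^ 2 / 2 := by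
        simp only [Finset.mul_sum, Finset.sum_div]
        refine Finset.sum_congr rfl fun i _ => Finset.sum_congr rfl fun j _ => ?_
        ring
    _ ≤ ρ / (N * Pop ^ 2) * (∑ i, (∑ j, H i j * e j) ^ 2) / 2 ^ 2 / 2 := by
        gcongr with i
        exact (he.mul_of_nonneg fun j => (hH i j).le).sum_sq_le_sq_sum

lemma constU_pos {σ : Fin M → Fin N → ℝ} (hσ : ∀ i j, 0 < σ i j) {Pop : ℝ} (hPop : Pop ≠ 0)
    (hN : 0 < N) : 0 < constU σ Pop := by
  have h : 0 < ∏ i, ∏ j, √(σ i j ^ 2) :=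
    Finset.prod_pos fun i _ => Finset.prod_pos fun j _ => sqrt_pos.2 (pow_pos (hσ i j) 2)
  unfold constU
  positivity

lemma eventually_lowerBound_le_pep_mul (hM : 0 < M) (hN : 0 < N) (μ : Fin M → Fin N → ℝ)
    {σ : Fin M → Fin N → ℝ} (hσ : ∀ i j, 0 < σ i j) (Pop : ℝ) (e : Fin N → ℝ) {c : ℝ}
    (hc : 0 < c) : ∀ᶠ ρ in atTop, lowerBound σ Pop e ρ ≤ pep μ σ Pop e (c * ρ) := by
  set A := log (Pop ^ 2 * bigOmega σ) - log (M * ∑ k, e k ^ 2) with hA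
  set K := √(c * M / (N * Pop ^ 2)) * (∑ j, |e j|) / 2 with hK
  filter_upwards [eventually_gt_atTop 0, tendsto_log_atTop.eventually_gt_atTop 0,
    tendsto_log_atTop.eventually (eventually_mul_inv_pow_le_exp (constL σ e) (M * N)),
    tendsto_log_atTop.eventually
      (eventually_exp_le_gaussianQ_mul_sqrt (K := K) (by positivity)),
    eventually_exp_le_channelLaw_real_channelBox hM hN μ hσ A (K ^ 2 + 2)]
    with ρ hρ hℓ hconst hQ hbox
  have hK_mul : √(c * ρ * M / (N * Pop ^ 2)) * (√(log ρ / ρ) * ∑ j, |e j|) / 2 =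
      K * √(log ρ) := by
    have : √(c * ρ * M / (N * Pop ^ 2)) * √(log ρ / ρ) = √(c * M / (N * Pop ^ 2)) * √(log ρ) := by
      rw [← sqrt_mul (by positivity), ← sqrt_mul (by positivity)]
      congr 1
      field_simp
    rw [hK, ← mul_assoc, this]
    ring
  calc lowerBound σ Pop e ρ
      ≤ exp (log ρ) * exp (-∑ i, ∑ j, (log ρ + A) ^ 2 / (8 * σ i j ^ 2)) := by
        simp only [lowerBound, hA, ← add_sub_assoc]
        gcongr
    _ = exp (-((K ^ 2 + 1) * log ρ)) *
          exp ((K ^ 2 + 2) * log ρ - ∑ i, ∑ j, (log ρ + A) ^ 2 / (8 * σ i j ^ 2)) := by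
        rw [← exp_add, ← exp_add]
        ring_nf
    _ ≤ gaussianQ (K * √(log ρ)) * (channelLaw μ σ).real (channelBox M N √(log ρ / ρ)) := by
        gcongr
        exact gaussianQ_nonneg _
    _ ≤ pep μ σ Pop e (c * ρ) := by
        rw [← hK_mul]
        exact gaussianQ_mul_channelLaw_real_le_pep μ σ Pop e (by positivity) (sqrt_nonneg _)

lemma eventually_pep_mul_le_upperBound (hM : 0 < M) (hN : 0 < N) (μ : Fin M → Fin N → ℝ)
    {σ : Fin M → Fin N → ℝ} (hσ : ∀ i j, 0 < σ i j) {Pop : ℝ} (hPop : Pop ≠ 0)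
    {e : Fin N → ℝ} (huni : IsUnipolar e) (hne : ∀ j, e j ≠ 0) {c : ℝ} (hc : 0 < c) :
    ∀ᶠ ρ in atTop, pep μ σ Pop e (c * ρ) ≤ upperBound σ Pop e ρ := by
  have hκ (j : Fin N) : 0 < c * e j ^ 2 / (8 * (N * Pop ^ 2)) := by
    have := hne j
    positivity
  filter_upwards [eventually_ge_atTop 0,
    tendsto_log_atTop.eventually
      (eventually_exp_neg_le_mul_inv_pow (constU_pos hσ hPop hN) (M * N)),
    eventually_integral_channelLaw_exp_le hM hN μ hσ hκ
      (fun j => log (Pop ^ 2 * bigOmega σ) - log (e j ^ 2)) 1] with ρ hρ hconst hint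
  calc pep μ σ Pop e (c * ρ)
      ≤ ∫ H, exp (-∑ i, ∑ j, c * ρ * e j ^ 2 / (8 * (N * Pop ^ 2)) * H i j ^ 2)
          ∂channelLaw μ σ := pep_le_integral_exp μ σ Pop huni (by positivity)
    _ = ∫ H, exp (-∑ i, ∑ j, c * e j ^ 2 / (8 * (N * Pop ^ 2)) * ρ * H i j ^ 2)
          ∂channelLaw μ σ := by
        simp only [mul_right_comm c ρ, mul_div_right_comm _ ρ]
    _ ≤ upperBound σ Pop e ρ := by
        refine hint.trans ?_
        rw [one_mul, sub_eq_add_neg, exp_add]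
        simp only [upperBound, ← add_sub_assoc]
        gcongr

end PairwiseErrorProbability

section MaximumLikelihood

variable {M N : ℕ}

lemma likelihood_le_iff {Pop : ℝ} {v : ℝ≥0} (hv : v ≠ 0) (H : Fin M → Fin N → ℝ)
    (x x' : Fin N → ℝ) (n : Fin M → ℝ) :
    likelihood Pop v H (received Pop H x n) x ≤ likelihood Pop v H (received Pop H x n) x' ↔
      ∑ i, n i * (1 / Pop * ∑ j, H i j * (x - x') j) ≤
        -((∑ i, (1 / Pop * ∑ j, H i j * (x - x') j) ^ 2) / 2) := by
  have : (0 : ℝ) < v := by exact_mod_cast pos_iff_ne_zero.2 hv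
  have hsq (i : Fin M) : -(1 / Pop * ∑ j, H i j * x j + n i - 1 / Pop * ∑ j, H i j * x' j) ^ 2
      = -(1 / Pop * ∑ j, H i j * x j + n i - 1 / Pop * ∑ j, H i j * x j) ^ 2
        - 2 * (n i * (1 / Pop * ∑ j, H i j * (x - x') j))
        - (1 / Pop * ∑ j, H i j * (x - x') j) ^ 2 := by
    simp only [Pi.sub_apply, mul_sub, Finset.sum_sub_distrib]
    ring
  simp only [likelihood, received, gaussianPDFReal, Finset.prod_mul_distrib, ← exp_sum]
  rw [mul_le_mul_iff_right₀ (Finset.prod_pos fun i _ => by positivity), exp_le_exp,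
    ← Finset.sum_div, ← Finset.sum_div, div_le_div_iff_of_pos_right (by positivity)]
  simp only [hsq, Finset.sum_sub_distrib, ← Finset.mul_sum]
  constructor <;> intro h <;> linarith

lemma pi_gaussianReal_real_halfSpace {ι : Type*} [Fintype ι] {v : ℝ≥0} (hv : v ≠ 0) {δ : ι → ℝ}
    (hδ : 0 < ∑ i, δ i ^ 2) :
    (Measure.pi fun _ : ι => gaussianReal 0 v).real
      {n | ∑ i, n i * δ i ≤ -((∑ i, δ i ^ 2) / 2)} = gaussianQ (√((∑ i, δ i ^ 2) / v) / 2) := by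
  have hvar : (∑ i, δ i ^ 2).toNNReal * v ≠ 0 := mul_ne_zero (toNNReal_pos.2 hδ).ne' hv
  have hmap := map_measureReal_apply (μ := Measure.pi fun _ : ι => gaussianReal 0 v)
    (f := fun n => ∑ i, n i * δ i) (by fun_prop) (measurableSet_Iic (a := -((∑ i, δ i ^ 2) / 2)))
  rw [map_sum_mul_pi_gaussianReal, gaussianReal_real_Iic 0 hvar] at hmap
  refine hmap.symm.trans (congrArg gaussianQ ?_)
  rw [NNReal.coe_mul, coe_toNNReal _ hδ.le, sqrt_mul hδ.le, sqrt_div hδ.le, zero_sub, neg_neg,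
    div_right_comm, ← div_div, div_sqrt]

lemma sum_sq_sum_mul_pos (hM : 0 < M) {e : Fin N → ℝ} (he : e ≠ 0) (huni : IsUnipolar e)
    {H : Fin M → Fin N → ℝ} (hH : ∀ i j, 0 < H i j) : 0 < ∑ i, (∑ j, H i j * e j) ^ 2 := by
  obtain ⟨j, hj⟩ := Function.ne_iff.1 he
  have : Nonempty (Fin M) := ⟨⟨0, hM⟩⟩
  refine Finset.sum_pos (fun i _ => ?_) Finset.univ_nonempty
  calc 0 < (H i j * e j) ^ 2 := sq_pos_of_ne_zero (mul_ne_zero (hH i j).ne' hj)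
    _ ≤ ∑ j, (H i j * e j) ^ 2 :=
        Finset.single_le_sum (fun j _ => sq_nonneg (H i j * e j)) (Finset.mem_univ j)
    _ ≤ (∑ j, H i j * e j) ^ 2 :=
        (huni.mul_of_nonneg fun j => (hH i j).le).sum_sq_le_sq_sum

lemma mlPairwiseError_eq_pep (hM : 0 < M) (μ σ : Fin M → Fin N → ℝ) {Pop : ℝ} (hPop : Pop ≠ 0)
    {x x' : Fin N → ℝ} (hxx' : x ≠ x') (huni : IsUnipolar (x - x')) {v : ℝ≥0} (hv : v ≠ 0) :
    mlPairwiseError μ σ Pop x x' v = pep μ σ Pop (x - x') (N / v) := by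
  obtain ⟨j, -⟩ := Function.ne_iff.1 hxx'
  have hN : (0 : ℝ) < N := by exact_mod_cast j.pos
  simp only [mlPairwiseError, likelihood_le_iff hv]
  rw [measureReal_def, Measure.prod_apply (measurableSet_le (by fun_prop) (by fun_prop)),
    ← integral_toReal (measurable_measure_prodMk_left
      (measurableSet_le (by fun_prop) (by fun_prop))).aemeasurable
      (Eventually.of_forall fun H => measure_lt_top _ _)]
  refine integral_congr_ae ?_
  filter_upwards [ae_channelLaw_pos μ σ] with H hH
  have hsum : ∑ i, (1 / Pop * ∑ j, H i j * (x - x') j) ^ 2 =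
      (∑ i, (∑ j, H i j * (x - x') j) ^ 2) / Pop ^ 2 := by
    simp only [mul_pow, inv_pow, mul_one, ← Finset.mul_sum, div_eq_inv_mul]
  have hpos : 0 < ∑ i, (1 / Pop * ∑ j, H i j * (x - x') j) ^ 2 := by
    rw [hsum]
    exact div_pos (sum_sq_sum_mul_pos hM (sub_ne_zero.2 hxx') huni hH) (by positivity)
  refine (pi_gaussianReal_real_halfSpace hv hpos).trans ?_
  rw [hsum, distance]
  congr 3
  field_simp

end MaximumLikelihood

lemma asymptoticallyBounded_of_eventually_mem_Icc {A P B R : ℝ → ℝ}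
    (h : ∀ᶠ ρ in atTop, P ρ ∈ Icc (A ρ) (B ρ)) : AsymptoticallyBounded A P B R :=
  ⟨h.mono fun _ hρ => hρ.1, 0, isBigO_zero R atTop, h.mono fun ρ hρ => by simpa using hρ.2⟩

end MimoOwc

theorem theorem1_general {M N : ℕ} (hM : 0 < M) (μ σ : Fin M → Fin N → ℝ)
    (hσ : ∀ i j, 0 < σ i j) {Pop : ℝ} (hPop : Pop ≠ 0) {x x' : Fin N → ℝ} (hxx' : x ≠ x')
    (huni : MimoOwc.IsUnipolar (x - x')) (hne : ∀ j, (x - x') j ≠ 0) {c : ℝ} (hc : 0 < c) :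
    (∀ᶠ ρ in atTop, MimoOwc.pep μ σ Pop (x - x') (c * ρ) ∈
      Set.Icc (MimoOwc.lowerBound σ Pop (x - x') ρ) (MimoOwc.upperBound σ Pop (x - x') ρ)) ∧
    ∀ᶠ ρ in atTop, MimoOwc.mlPairwiseError μ σ Pop x x' (Real.toNNReal (c / (N * ρ))) ∈
      Set.Icc (MimoOwc.lowerBound σ Pop (x - x') ρ) (MimoOwc.upperBound σ Pop (x - x') ρ) := by
  obtain ⟨j, -⟩ := Function.ne_iff.1 hxx'
  have hN : 0 < N := j.pos
  have hpep {a : ℝ} (ha : 0 < a) : ∀ᶠ ρ in atTop, MimoOwc.pep μ σ Pop (x - x') (a * ρ) ∈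
      Set.Icc (MimoOwc.lowerBound σ Pop (x - x') ρ) (MimoOwc.upperBound σ Pop (x - x') ρ) :=
    (MimoOwc.eventually_lowerBound_le_pep_mul hM hN μ hσ Pop (x - x') ha).and
      (MimoOwc.eventually_pep_mul_le_upperBound hM hN μ hσ hPop huni hne ha)
  refine ⟨hpep hc, ?_⟩
  -- Noise variance `c / (N * ρ)` is signal-to-noise ratio `N / (c / (N * ρ)) = N ^ 2 / c * ρ`.
  filter_upwards [hpep (a := N ^ 2 / c) (by positivity), eventually_gt_atTop 0] with ρ hρ hρ0
  have hv : 0 < c / (N * ρ) := by positivity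
  rw [MimoOwc.mlPairwiseError_eq_pep hM μ σ hPop hxx' huni (Real.toNNReal_pos.2 hv).ne',
    Real.coe_toNNReal _ hv.le]
  convert hρ using 2
  field_simp

theorem theorem1 {L M N : ℕ} (hM : 0 < M)
    (B : Finset ℝ) (F : Fin L → ℝ → Fin N → ℝ)
    (μ σ : Fin M → Fin N → ℝ) (hσ : ∀ i j, 0 < σ i j)
    (hP : 0 < MimoOwc.averagePower B F)
    (hE : ∀ e ∈ MimoOwc.errorSet B F, MimoOwc.IsUnipolar e ∧ ∀ j, e j ≠ 0)
    (s s' : Fin L → ℝ)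
    (hs : s ∈ MimoOwc.symbolVectors L B) (hs' : s' ∈ MimoOwc.symbolVectors L B)
    (hss' : MimoOwc.codeword F s ≠ MimoOwc.codeword F s')
    (Pop : ℝ) (hPop : Pop = MimoOwc.averagePower B F)
    (e : Fin N → ℝ) (he : e = MimoOwc.codeword F s - MimoOwc.codeword F s') :
    MimoOwc.AsymptoticallyBounded
      (MimoOwc.lowerBound σ Pop e)
      (MimoOwc.pep μ σ Pop e)
      (MimoOwc.upperBound σ Pop e)
      (MimoOwc.remainder σ) ∧
    MimoOwc.AsymptoticallyBounded
      (MimoOwc.lowerBound σ Pop e)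
      (fun ρ => MimoOwc.mlPairwiseError μ σ Pop (MimoOwc.codeword F s) (MimoOwc.codeword F s')
        (Real.toNNReal (1 / (N * ρ))))
      (MimoOwc.upperBound σ Pop e)
      (MimoOwc.remainder σ) := by
  obtain ⟨huni, hne⟩ := hE e ⟨s, hs, s', hs', hss', he⟩
  subst he
  have h := theorem1_general hM μ σ hσ (hPop.trans_gt hP).ne' hss' huni hne one_pos
  simp only [one_mul] at h
  exact ⟨MimoOwc.asymptoticallyBounded_of_eventually_mem_Icc h.1,
    MimoOwc.asymptoticallyBounded_of_eventually_mem_Icc h.2⟩
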